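/- Let $G=(V,E)$ be an infinite, locally finite, connected graph without loops or multiple edges, with Laplacian $\Delta f(x)=\sum_{y\sim x}(f(x)-f(y))$ and graph distance $d$. Let $p_t(x,y)$ be the heat kernel of $G$, that is, $p_t(x,y)=\lim_{r\to\infty}p^r_t(x,y)$, where $p^r_t(x,y)=e^{-t\Delta_r}\delta_x(y)$ is the heat kernel of the ball $B_r$ of radius $r$ about a base vertex (whose choice does not matter), with Dirichlet boundary conditions, extended by $0$; here $\Delta_r$ is $\Delta$ acting on functions supported in the interior of $B_r$ (the set of vertices of $B_r$ all of whose neighbours lie in $B_r$) and restricted to that interior, and $p^r_t(x,y)=0$ unless $x$ and $y$ both lie in that interior. The graph $G$ is called stochastically incomplete if $\sum_{y\in V}p_t(x,y)<1$ for some vertex $x$ and some $t>0$. Let $V=H\cup H^C$ be a partition of the vertex set and let $x_0\in H$ be such that no vertex of $H$ other than $x_0$ has a neighbour in $H^C$. Let $S_r(x_0)=\{x: d(x,x_0)=r\}$ and, for $x\in S_r(x_0)$, let $m_{\pm1}(x)$ be the number of neighbours of $x$ in $S_{r\pm1}(x_0)$. Suppose that for every $r\ge 1$ the set $S_r(x_0)\cap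 H$ is non-empty and $$\underline m^H_{+1}(r)=\min_{x\in S_r(x_0)\cap H}m_{+1}(x)>0,$$ and put $\overline m^H_{-1}(r)=\max_{x\in S_r(x_0)\cap H}m_{-1}(x)$. If $$\sum_{r=1}^\infty\frac{\overline m^H_{-1}(r)}{\underline m^H_{+1}(r)}<\infty,$$ then $G$ is stochastically incomplete. -/

import Mathlib

namespace GraphHeat

section

variable {V : Type*} (G : SimpleGraph V)

/-- The ball of radius `r` about `o`: the vertices at distance at most `r` from `o`. -/
def ball (o : V) (r : ℕ) : Set V := {x | G.edist o x ≤ r}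

/-- The sphere of radius `r` about `o`: the vertices at distance exactly `r` from `o`. -/
def sphere (o : V) (r : ℕ) : Set V := {x | G.edist o x = r}

/-- The number of neighbours of `x` that are one step further from `o` than `x` is. -/
noncomputable def mPlus (o x : V) : ℕ :=
  {y | G.Adj x y ∧ G.edist o y = G.edist o x + 1}.ncard

/-- The number of neighbours of `x` that are one step closer to `o` than `x` is. -/
noncomputable def mMinus (o x : V) : ℕ :=
  {y | G.Adj x y ∧ G.edist o y + 1 = G.edist o x}.ncard

/-- The minimum of `mPlus` over the vertices of `H` at distance `r` from `o`. -/
noncomputable def minPlus (H : Set V) (o : V) (r : ℕ) : ℕ :=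
  sInf (mPlus G o '' (sphere G o r ∩ H))

/-- The maximum of `mMinus` over the vertices of `H` at distance `r` from `o`. (The sphere is
finite in a locally finite graph, so the supremum is a maximum.) -/
noncomputable def maxMinus (H : Set V) (o : V) (r : ℕ) : ℕ :=
  sSup (mMinus G o '' (sphere G o r ∩ H))

variable [G.LocallyFinite]

/-- The Laplacian `Δ f (x) = ∑_{y ∼ x} (f x - f y)`. -/
def laplacian : (V → ℝ) →ₗ[ℝ] (V → ℝ) where
  toFun f x := ∑ y ∈ G.neighborFinset x, (f x - f y)
  map_add' f g := by
    funext x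
    simp only [Pi.add_apply, ← Finset.sum_add_distrib]
    exact Finset.sum_congr rfl fun y _ => by ring
  map_smul' c f := by
    funext x
    simp only [Pi.smul_apply, smul_eq_mul, RingHom.id_apply, Finset.mul_sum]
    exact Finset.sum_congr rfl fun y _ => by ring

theorem ball_finite (o : V) (r : ℕ) : (ball G o r).Finite := by
  induction r with
  | zero =>
    refine (Set.finite_singleton o).subset fun x hx => ?_
    have h : G.edist o x ≤ ((0 : ℕ) : ℕ∞) := hx
    have h0 : G.edist o x = 0 := le_antisymm (h.trans (by simp)) bot_le
    exact (SimpleGraph.edist_eq_zero_iff.1 h0).symm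
  | succ r ih =>
    refine (ih.union (ih.biUnion fun y _ => (G.neighborFinset y).finite_toSet)).subset
      fun x hx => ?_
    have hx' : G.edist o x ≤ ((r + 1 : ℕ) : ℕ∞) := hx
    have hne : G.edist o x ≠ ⊤ := ne_top_of_le_ne_top (ENat.natCast_ne_top _) hx'
    obtain ⟨p, hp⟩ := SimpleGraph.exists_walk_of_edist_ne_top hne
    rw [← hp] at hx'
    have hlen : p.length ≤ r + 1 := by exact_mod_cast hx'
    by_cases hnil : p.Nil
    · left
      have h0 : p.length = 0 := SimpleGraph.Walk.length_eq_zero_iff.2 hnil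
      rw [h0] at hp
      change G.edist o x ≤ (r : ℕ∞)
      rw [← hp]
      simp
    · right
      have hlast := p.adj_penultimate hnil
      refine Set.mem_biUnion (x := p.penultimate) ?_ (by simpa using hlast)
      change G.edist o p.penultimate ≤ (r : ℕ∞)
      refine (SimpleGraph.edist_le p.dropLast).trans ?_
      have hd : p.dropLast.length ≤ r := by
        have := p.length_dropLast_add_one hnil
        omega
      exact_mod_cast hd

theorem interior_finite (o : V) (r : ℕ) :
    {x | x ∈ ball G o r ∧ ∀ y, G.Adj x y → y ∈ ball G o r}.Finite :=
  (ball_finite G o r).subset fun _ hx => hx.1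

/-- The interior of the ball of radius `r` about `o`: the vertices of the ball all of whose
neighbours are in the ball. -/
noncomputable def interiorBall (o : V) (r : ℕ) : Finset V := (interior_finite G o r).toFinset

open Classical in
/-- Extension by zero of a function on the interior of a ball. The functions on the ball that
vanish on its boundary are identified with the functions on its interior. -/
noncomputable def extendZero (o : V) (r : ℕ) : (interiorBall G o r → ℝ) →ₗ[ℝ] (V → ℝ) where
  toFun f x := if h : x ∈ interiorBall G o r then f ⟨x, h⟩ else 0
  map_add' f g := by
    funext x
    by_cases h : x ∈ interiorBall G o r <;> simp [h]
  map_smul' c f := by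
    funext x
    by_cases h : x ∈ interiorBall G o r <;> simp [h]

/-- The reduced (Dirichlet) Laplacian of the ball of radius `r` about `o`: extend by zero, apply
the Laplacian, and restrict to the interior. -/
noncomputable def reducedLaplacian (o : V) (r : ℕ) :
    (interiorBall G o r → ℝ) →L[ℝ] (interiorBall G o r → ℝ) :=
  LinearMap.toContinuousLinearMap
    (LinearMap.funLeft ℝ ℝ (Subtype.val : interiorBall G o r → V) ∘ₗ
      laplacian G ∘ₗ extendZero G o r)

open Classical in
/-- The Dirichlet heat kernel `e^{-tΔ_r} δ_x (y)` of the ball of radius `r` about `o`, extended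
by zero to all vertices. -/
noncomputable def dirichletHeatKernel (o : V) (r : ℕ) (t : ℝ) (x y : V) : ℝ :=
  if hx : x ∈ interiorBall G o r then
    extendZero G o r
      (NormedSpace.exp ((-t) • reducedLaplacian G o r) (Pi.single ⟨x, hx⟩ 1)) y
  else 0

/-- The heat kernel `p_t(x, y)`: the limit, along the exhaustion by balls about `o`, of the
(increasing and bounded) Dirichlet heat kernels. In a connected graph it does not depend
on `o`. -/
noncomputable def heatKernel (o : V) (t : ℝ) (x y : V) : ℝ :=
  Filter.limUnder Filter.atTop fun r : ℕ => dirichletHeatKernel G o r t x y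

/-- Stochastic incompleteness: `∑_y p_t(x, y) < 1` for some vertex `x` and some `t > 0`. The heat
kernel may be constructed from any base vertex `o`. That the limits and the sum involved exist
always holds in a connected graph; it is included so that no default value can enter. -/
def StochasticallyIncomplete : Prop :=
  ∀ o : V, ∃ x : V, ∃ t : ℝ, 0 < t ∧
    (∀ y, Filter.Tendsto (fun r : ℕ => dirichletHeatKernel G o r t x y) Filter.atTop
      (nhds (heatKernel G o t x y))) ∧
    Summable (fun y => heatKernel G o t x y) ∧ ∑' y, heatKernel G o t x y < 1

end

end GraphHeat

/-! Mass is lost once some `v ≤ 1` with `Δv ≤ -v` is positive somewhere. Pairing `e^{-s} v - 1` with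
the Dirichlet heat flow gives a quantity nondecreasing in `s`, so the mass at time `t` started at
`x` is at most `(1 - v x) / (1 - e^{-t})`, uniformly in the ball; for large `t` this is below `1`
(`sum_exp_reducedLaplacian_le`, `stochasticallyIncomplete_of_subharmonic`). Such a `v` is radial on
`H` and zero off `H`. It vanishes at `x₀`, the only vertex of `H` that can touch the complement, so
the two pieces glue. From one sphere to the next it grows by the factor `1 + 2 m₋ / m₊` (maximum
over minimum on `H`): the outward gain outweighs the inward loss, and summability of the ratios
keeps the infinite product finite, so `v` can be normalised to be at most `1`. -/

namespace GraphHeat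

/-- Termwise comparison of two exponential series. -/
theorem exp_smul_apply_le {E F : Type*} [NormedAddCommGroup E] [NormedSpace ℝ E] [CompleteSpace E]
    [NormedAddCommGroup F] [NormedSpace ℝ F] [CompleteSpace F]
    (A : E →L[ℝ] E) (B : F →L[ℝ] F) (φ : E →L[ℝ] ℝ) (χ : F →L[ℝ] ℝ) (f : E) (g : F)
    (h : ∀ n : ℕ, φ ((A ^ n) f) ≤ χ ((B ^ n) g)) {t : ℝ} (ht : 0 ≤ t) :
    φ (NormedSpace.exp (t • A) f) ≤ χ (NormedSpace.exp (t • B) g) := by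
  have hA := φ.hasSum ((ContinuousLinearMap.apply ℝ E f).hasSum
    (NormedSpace.exp_series_hasSum_exp' (𝕂 := ℝ) (t • A)))
  have hB := χ.hasSum ((ContinuousLinearMap.apply ℝ F g).hasSum
    (NormedSpace.exp_series_hasSum_exp' (𝕂 := ℝ) (t • B)))
  refine hasSum_le (fun n => ?_) hA hB
  simp only [smul_pow, map_smul, ContinuousLinearMap.apply_apply, smul_eq_mul]
  have := h n
  gcongr

/-- Scalars commute with `L`. For large `c` the operator `c - Δ_r` has nonnegative entries, so its
exponential series can be compared term by term, which fails for `-Δ_r`. -/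
theorem exp_neg_smul_eq {E : Type*} [NormedAddCommGroup E] [NormedSpace ℝ E] [CompleteSpace E]
    (L : E →L[ℝ] E) (c t : ℝ) :
    NormedSpace.exp ((-t) • L) =
      Real.exp (-(t * c)) • NormedSpace.exp (t • (c • (1 : E →L[ℝ] E) - L)) := by
  have h : (-t) • L = algebraMap ℝ (E →L[ℝ] E) (-(t * c)) + t • (c • (1 : E →L[ℝ] E) - L) := by
    rw [Algebra.algebraMap_eq_smul_one, smul_sub, smul_smul, neg_smul, neg_smul]
    abel
  let : NormedAlgebra ℚ (E →L[ℝ] E) := NormedAlgebra.restrictScalars ℚ ℝ _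
  rw [h, NormedSpace.exp_add_of_commute (Algebra.commutes _ _), ← NormedSpace.algebraMap_exp_comm,
    ← Real.exp_eq_exp_ℝ, Algebra.algebraMap_eq_smul_one, smul_mul_assoc, one_mul]

/-! ### Positivity and domain monotonicity of the Dirichlet heat kernels -/

section

variable {V : Type*} (G : SimpleGraph V)

theorem ball_mono (o : V) {r R : ℕ} (h : r ≤ R) : ball G o r ⊆ ball G o R := by
  intro x hx
  have hx' : G.edist o x ≤ (r : ℕ∞) := hx
  exact hx'.trans (by exact_mod_cast h)

variable [G.LocallyFinite]

theorem mem_interiorBall {o : V} {r : ℕ} {x : V} :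
    x ∈ interiorBall G o r ↔ x ∈ ball G o r ∧ ∀ y, G.Adj x y → y ∈ ball G o r := by
  simp [interiorBall]

theorem interiorBall_mono (o : V) {r R : ℕ} (h : r ≤ R) :
    interiorBall G o r ⊆ interiorBall G o R := by
  intro x hx
  rw [mem_interiorBall] at hx ⊢
  exact ⟨ball_mono G o h hx.1, fun y hy => ball_mono G o h (hx.2 y hy)⟩

theorem extendZero_of_mem {o : V} {r : ℕ} (f : interiorBall G o r → ℝ) {x : V}
    (hx : x ∈ interiorBall G o r) : extendZero G o r f x = f ⟨x, hx⟩ := by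
  simp [extendZero, hx]

theorem extendZero_of_notMem {o : V} {r : ℕ} (f : interiorBall G o r → ℝ) {x : V}
    (hx : x ∉ interiorBall G o r) : extendZero G o r f x = 0 := by
  simp [extendZero, hx]

theorem extendZero_nonneg {o : V} {r : ℕ} {f : interiorBall G o r → ℝ} (hf : 0 ≤ f) (x : V) :
    0 ≤ extendZero G o r f x := by
  by_cases hx : x ∈ interiorBall G o r
  · rw [extendZero_of_mem G f hx]; exact hf _
  · rw [extendZero_of_notMem G f hx]

theorem laplacian_apply (f : V → ℝ) (x : V) :
    laplacian G f x = ∑ y ∈ G.neighborFinset x, (f x - f y) := rfl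

theorem laplacian_eq (f : V → ℝ) (x : V) :
    laplacian G f x = (G.degree x : ℝ) * f x - ∑ y ∈ G.neighborFinset x, f y := by
  simp [laplacian_apply, Finset.sum_sub_distrib]

theorem reducedLaplacian_apply (o : V) (r : ℕ) (f : interiorBall G o r → ℝ)
    (x : interiorBall G o r) :
    reducedLaplacian G o r f x = laplacian G (extendZero G o r f) x := rfl

/-- The nonnegative operator `c - Δ_r` for large `c`. -/
noncomputable def shiftedLaplacian (o : V) (r : ℕ) (c : ℝ) :
    (interiorBall G o r → ℝ) →L[ℝ] (interiorBall G o r → ℝ) :=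
  c • (1 : (interiorBall G o r → ℝ) →L[ℝ] (interiorBall G o r → ℝ)) - reducedLaplacian G o r

theorem shiftedLaplacian_apply (o : V) (r : ℕ) (c : ℝ) (f : interiorBall G o r → ℝ)
    (x : interiorBall G o r) :
    shiftedLaplacian G o r c f x =
      (c - G.degree (x : V)) * f x + ∑ y ∈ G.neighborFinset (x : V), extendZero G o r f y := by
  have h : shiftedLaplacian G o r c f x = c * f x - reducedLaplacian G o r f x := rfl
  rw [h, reducedLaplacian_apply, laplacian_eq, extendZero_of_mem G f x.2]
  ring

theorem shiftedLaplacian_nonneg {o : V} {r : ℕ} {c : ℝ}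
    (hc : ∀ x ∈ interiorBall G o r, (G.degree x : ℝ) ≤ c) {f : interiorBall G o r → ℝ}
    (hf : 0 ≤ f) : 0 ≤ shiftedLaplacian G o r c f := by
  intro x
  rw [shiftedLaplacian_apply]
  have h1 := hc x x.2
  exact add_nonneg (mul_nonneg (by linarith) (hf x))
    (Finset.sum_nonneg fun y _ => extendZero_nonneg G hf y)

theorem shiftedLaplacian_pow_nonneg {o : V} {r : ℕ} {c : ℝ}
    (hc : ∀ x ∈ interiorBall G o r, (G.degree x : ℝ) ≤ c) {f : interiorBall G o r → ℝ}
    (hf : 0 ≤ f) (n : ℕ) : 0 ≤ (shiftedLaplacian G o r c ^ n) f := by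
  induction n with
  | zero => simpa using hf
  | succ n ih =>
    rw [pow_succ']
    exact shiftedLaplacian_nonneg G hc ih

/-- On the smaller interior both operators have the same nonnegative coefficients; elsewhere the
left side is zero. One `c`, dominating the degrees in the larger interior, serves both radii. -/
theorem extendZero_shiftedLaplacian_le {o : V} {r R : ℕ} (hr : r ≤ R) {c : ℝ}
    (hc : ∀ x ∈ interiorBall G o R, (G.degree x : ℝ) ≤ c) {f : interiorBall G o r → ℝ}
    {g : interiorBall G o R → ℝ} (hg : 0 ≤ g)
    (h : ∀ x, extendZero G o r f x ≤ extendZero G o R g x) (x : V) :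
    extendZero G o r (shiftedLaplacian G o r c f) x ≤
      extendZero G o R (shiftedLaplacian G o R c g) x := by
  by_cases hx : x ∈ interiorBall G o r
  · have hx' := interiorBall_mono G o hr hx
    rw [extendZero_of_mem G _ hx, extendZero_of_mem G _ hx', shiftedLaplacian_apply,
      shiftedLaplacian_apply]
    have h1 := h x
    rw [extendZero_of_mem G _ hx, extendZero_of_mem G _ hx'] at h1
    have h2 := hc x hx'
    exact add_le_add (mul_le_mul_of_nonneg_left h1 (by simpa using h2))
      (Finset.sum_le_sum fun y _ => h y)
  · rw [extendZero_of_notMem G _ hx]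
    exact extendZero_nonneg G (shiftedLaplacian_nonneg G hc hg) x

theorem extendZero_shiftedLaplacian_pow_le {o : V} {r R : ℕ} (hr : r ≤ R) {c : ℝ}
    (hc : ∀ x ∈ interiorBall G o R, (G.degree x : ℝ) ≤ c) {f : interiorBall G o r → ℝ}
    {g : interiorBall G o R → ℝ} (hg : 0 ≤ g)
    (h : ∀ x, extendZero G o r f x ≤ extendZero G o R g x) (n : ℕ) (x : V) :
    extendZero G o r ((shiftedLaplacian G o r c ^ n) f) x ≤
      extendZero G o R ((shiftedLaplacian G o R c ^ n) g) x := by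
  induction n generalizing x with
  | zero => simpa using h x
  | succ n ih =>
    rw [pow_succ', pow_succ']
    exact extendZero_shiftedLaplacian_le G hr hc (shiftedLaplacian_pow_nonneg G hc hg n) ih x

theorem degree_le_sum (o : V) (r : ℕ) :
    ∀ x ∈ interiorBall G o r, (G.degree x : ℝ) ≤ ∑ z ∈ interiorBall G o r, (G.degree z : ℝ) :=
  fun _ hx => Finset.single_le_sum (f := fun z => (G.degree z : ℝ))
    (fun _ _ => Nat.cast_nonneg _) hx

/-- The value at `x` of the extension by zero, as a continuous linear functional. -/
noncomputable def extendZeroEval (o : V) (r : ℕ) (x : V) : (interiorBall G o r → ℝ) →L[ℝ] ℝ :=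
  LinearMap.toContinuousLinearMap (LinearMap.proj x ∘ₗ extendZero G o r)

theorem extendZeroEval_apply (o : V) (r : ℕ) (x : V) (f : interiorBall G o r → ℝ) :
    extendZeroEval G o r x f = extendZero G o r f x := rfl

theorem exp_reducedLaplacian_mono {o : V} {r R : ℕ} (hr : r ≤ R) {f : interiorBall G o r → ℝ}
    {g : interiorBall G o R → ℝ} (hg : 0 ≤ g)
    (h : ∀ x, extendZero G o r f x ≤ extendZero G o R g x) {t : ℝ} (ht : 0 ≤ t) (x : V) :
    extendZero G o r (NormedSpace.exp ((-t) • reducedLaplacian G o r) f) x ≤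
      extendZero G o R (NormedSpace.exp ((-t) • reducedLaplacian G o R) g) x := by
  have hc := degree_le_sum G o R
  set c := ∑ z ∈ interiorBall G o R, (G.degree z : ℝ)
  have := exp_smul_apply_le (shiftedLaplacian G o r c) (shiftedLaplacian G o R c)
    (extendZeroEval G o r x) (extendZeroEval G o R x) f g
    (fun n => extendZero_shiftedLaplacian_pow_le G hr hc hg h n x) ht
  rw [exp_neg_smul_eq _ c, exp_neg_smul_eq _ c]
  rw [extendZeroEval_apply, extendZeroEval_apply] at this
  simp only [smul_apply, map_smul, Pi.smul_apply, smul_eq_mul]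
  exact mul_le_mul_of_nonneg_left this (Real.exp_nonneg _)

theorem exp_reducedLaplacian_nonneg {o : V} {r : ℕ} {f : interiorBall G o r → ℝ} (hf : 0 ≤ f)
    {t : ℝ} (ht : 0 ≤ t) : 0 ≤ NormedSpace.exp ((-t) • reducedLaplacian G o r) f := by
  intro x
  have := exp_reducedLaplacian_mono G (f := 0) le_rfl hf
    (fun y => by simpa using extendZero_nonneg G hf y) ht (x : V)
  rw [extendZero_of_mem G _ x.2, extendZero_of_mem G _ x.2] at this
  simpa using this

theorem dirichletHeatKernel_nonneg (o : V) (r : ℕ) {t : ℝ} (ht : 0 ≤ t) (x y : V) :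
    0 ≤ dirichletHeatKernel G o r t x y := by
  classical
  unfold dirichletHeatKernel
  split_ifs with hx
  · refine extendZero_nonneg G (exp_reducedLaplacian_nonneg G ?_ ht) y
    exact Pi.single_nonneg.2 zero_le_one
  · exact le_rfl

theorem dirichletHeatKernel_mono (o : V) {t : ℝ} (ht : 0 ≤ t) (x y : V) :
    Monotone fun r => dirichletHeatKernel G o r t x y := by
  classical
  intro r R hr
  by_cases hx : x ∈ interiorBall G o r
  · have hx' := interiorBall_mono G o hr hx
    simp only [dirichletHeatKernel, hx, hx', dif_pos]
    refine exp_reducedLaplacian_mono G hr (Pi.single_nonneg.2 zero_le_one) (fun z => ?_) ht y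
    by_cases hz : z ∈ interiorBall G o r
    · rw [extendZero_of_mem G _ hz, extendZero_of_mem G _ (interiorBall_mono G o hr hz)]
      simp [Pi.single_apply]
    · rw [extendZero_of_notMem G _ hz]
      exact extendZero_nonneg G (Pi.single_nonneg.2 zero_le_one) z
  · have h0 : dirichletHeatKernel G o r t x y = 0 := by simp [dirichletHeatKernel, hx]
    change dirichletHeatKernel G o r t x y ≤ _
    rw [h0]
    exact dirichletHeatKernel_nonneg G o R ht x y

end

/-! ### Mass loss from a bounded subharmonic function -/

theorem hasDerivAt_exp_neg_smul_apply {E : Type*} [NormedAddCommGroup E] [NormedSpace ℝ E]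
    [CompleteSpace E] (L : E →L[ℝ] E) (φ : E →L[ℝ] ℝ) (f : E) (t : ℝ) :
    HasDerivAt (fun s : ℝ => φ (NormedSpace.exp ((-s) • L) f))
      (φ (-L (NormedSpace.exp ((-t) • L) f))) t := by
  have h := hasDerivAt_exp_smul_const' (𝕂 := ℝ) (-L) t
  have e : ∀ s : ℝ, s • -L = (-s) • L := fun s => by rw [smul_neg, neg_smul]
  simp only [e] at h
  exact (φ ∘L ContinuousLinearMap.apply ℝ _ f).hasFDerivAt.comp_hasDerivAt t h

section
variable {V : Type*} (G : SimpleGraph V) [G.LocallyFinite]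

theorem sum_interiorBall_extendZero (o : V) (r : ℕ) (f : interiorBall G o r → ℝ) (F : V → ℝ) :
    ∑ z ∈ interiorBall G o r, extendZero G o r f z * F z = ∑ z, f z * F z := by
  rw [← Finset.sum_coe_sort]
  exact Finset.sum_congr rfl fun z _ => by rw [extendZero_of_mem G f z.2]

theorem sum_neighborFinset_extendZero (o : V) (r : ℕ) (f : interiorBall G o r → ℝ) (x : V) :
    ∑ y ∈ G.neighborFinset x, extendZero G o r f y =
      ∑ y : interiorBall G o r, (by classical exact if G.Adj x y then f y else 0) := by
  classical
  rw [← Finset.sum_subset (Finset.filter_subset (· ∈ interiorBall G o r) (G.neighborFinset x))]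
  · rw [← Finset.sum_filter]
    refine Finset.sum_bij' (fun y hy => ⟨y, (Finset.mem_filter.1 hy).2⟩) (fun y _ => y)
      ?_ ?_ ?_ ?_ ?_
    · intro y hy; simpa using (Finset.mem_filter.1 hy).1
    · intro y hy; simpa using hy
    · intros; rfl
    · intros; rfl
    · intro y hy; rw [extendZero_of_mem G f (Finset.mem_filter.1 hy).2]
  · intro y hy hy'
    exact extendZero_of_notMem G f fun h => hy' (Finset.mem_filter.2 ⟨hy, h⟩)

theorem reducedLaplacian_symm (o : V) (r : ℕ) (f g : interiorBall G o r → ℝ) :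
    ∑ x, reducedLaplacian G o r f x * g x = ∑ x, f x * reducedLaplacian G o r g x := by
  classical
  simp only [reducedLaplacian_apply, laplacian_eq, sum_neighborFinset_extendZero]
  simp only [sub_mul, mul_sub, Finset.sum_sub_distrib, Finset.sum_mul, Finset.mul_sum]
  congr 1
  · refine Finset.sum_congr rfl fun x _ => ?_
    rw [extendZero_of_mem G f x.2, extendZero_of_mem G g x.2]
    ring
  · rw [Finset.sum_comm]
    refine Finset.sum_congr rfl fun x _ => Finset.sum_congr rfl fun y _ => ?_
    simp only [G.adj_comm y x]
    split_ifs <;> simp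

/-- Restricting a `1`-subharmonic function bounded by `1` costs at most the number of
neighbours outside of the interior. -/
theorem reducedLaplacian_restrict_le (o : V) (r : ℕ) {v : V → ℝ} (h1 : ∀ x, v x ≤ 1)
    (hv : ∀ x, laplacian G v x ≤ - v x) (x : interiorBall G o r) :
    reducedLaplacian G o r (fun z => v z) x + v x ≤ reducedLaplacian G o r 1 x := by
  have h := hv x
  rw [laplacian_eq] at h
  simp only [reducedLaplacian_apply, laplacian_eq]
  rw [extendZero_of_mem G _ x.2, extendZero_of_mem G _ x.2]
  have key : ∑ y ∈ G.neighborFinset (x : V), (v y - extendZero G o r (fun z => v z) y) ≤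
      ∑ y ∈ G.neighborFinset (x : V), (1 - extendZero G o r 1 y) := by
    refine Finset.sum_le_sum fun y _ => ?_
    by_cases hy : y ∈ interiorBall G o r
    · rw [extendZero_of_mem G _ hy, extendZero_of_mem G _ hy]; simp
    · rw [extendZero_of_notMem G _ hy, extendZero_of_notMem G _ hy]; simpa using h1 y
  simp only [Finset.sum_sub_distrib, Finset.sum_const, SimpleGraph.card_neighborFinset_eq_degree,
    nsmul_eq_mul, mul_one] at key
  simp only [Pi.one_apply, mul_one]
  linarith

theorem reducedLaplacian_one_nonneg (o : V) (r : ℕ) (x : interiorBall G o r) :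
    0 ≤ reducedLaplacian G o r 1 x := by
  rw [reducedLaplacian_apply, laplacian_apply, extendZero_of_mem G _ x.2]
  refine Finset.sum_nonneg fun y _ => ?_
  by_cases hy : y ∈ interiorBall G o r
  · rw [extendZero_of_mem G _ hy]; simp
  · rw [extendZero_of_notMem G _ hy]; simp

theorem hasDerivAt_exp_reducedLaplacian (o : V) (r : ℕ) (f : interiorBall G o r → ℝ) (t : ℝ)
    (x : interiorBall G o r) :
    HasDerivAt (fun s : ℝ => NormedSpace.exp ((-s) • reducedLaplacian G o r) f x)
      (-reducedLaplacian G o r (NormedSpace.exp ((-t) • reducedLaplacian G o r) f) x) t := by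
  exact hasDerivAt_exp_neg_smul_apply (reducedLaplacian G o r)
    (ContinuousLinearMap.proj (R := ℝ) (φ := fun _ : interiorBall G o r => ℝ) x) f t

/-- Moving `Δ_r` from the flow onto `e^{-s} v - 1` by symmetry, the boundary terms of `v` are
absorbed by those of the constant `1`, because `v ≤ 1` and `e^{-s} ≤ 1`. Working with `-1` included
is what makes the truncation harmless. -/
theorem sum_exp_reducedLaplacian_le (o : V) (r : ℕ) {v : V → ℝ} (h1 : ∀ x, v x ≤ 1)
    (hv : ∀ x, laplacian G v x ≤ - v x) {f : interiorBall G o r → ℝ}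
    (hf : 0 ≤ f) {t : ℝ} (ht : 0 ≤ t) :
    (1 - Real.exp (-t)) * ∑ z, NormedSpace.exp ((-t) • reducedLaplacian G o r) f z ≤
      ∑ z, f z * (1 - v z) := by
  set L := reducedLaplacian G o r with hL
  let P : ℝ → interiorBall G o r → ℝ := fun s => NormedSpace.exp ((-s) • L) f
  let ψ : ℝ → ℝ := fun s => ∑ z, P s z * (Real.exp (-s) * v z - 1)
  have hder : ∀ s, HasDerivAt ψ (∑ z, ((-L (P s) z) * (Real.exp (-s) * v z - 1) +
      P s z * (-Real.exp (-s) * v z))) s := by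
    intro s
    refine HasDerivAt.fun_sum fun z _ => ?_
    refine (hasDerivAt_exp_reducedLaplacian G o r f s z).mul ?_
    exact (((hasDerivAt_neg s).exp.mul_const (v z)).sub_const 1).congr_deriv (by ring)
  have hnn : ∀ s, 0 ≤ s → 0 ≤ ∑ z, ((-L (P s) z) * (Real.exp (-s) * v z - 1) +
      P s z * (-Real.exp (-s) * v z)) := by
    intro s hs
    have hP : 0 ≤ P s := exp_reducedLaplacian_nonneg G hf hs
    have hsym := reducedLaplacian_symm G o r (P s)
      (Real.exp (-s) • (fun z : interiorBall G o r => v z) - 1)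
    have : ∑ z, ((-L (P s) z) * (Real.exp (-s) * v z - 1) + P s z * (-Real.exp (-s) * v z)) =
        ∑ z, P s z * (L 1 z - Real.exp (-s) * (L (fun z => v z) z + v z)) := by
      simp only [neg_mul, Finset.sum_add_distrib, Finset.sum_neg_distrib]
      simp only [Pi.sub_apply, Pi.smul_apply, smul_eq_mul, Pi.one_apply, map_sub, map_smul] at hsym
      rw [hsym, ← Finset.sum_neg_distrib, ← Finset.sum_add_distrib]
      exact Finset.sum_congr rfl fun z _ => by ring
    rw [this]
    refine Finset.sum_nonneg fun z _ => mul_nonneg (hP z) ?_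
    have ha := reducedLaplacian_restrict_le G o r h1 hv z
    have hb := reducedLaplacian_one_nonneg G o r z
    have he : Real.exp (-s) ≤ 1 := Real.exp_le_one_iff.2 (by linarith)
    have he0 := Real.exp_nonneg (-s)
    have := mul_le_mul_of_nonneg_left ha he0
    have := mul_le_mul_of_nonneg_right he hb
    linarith
  have hmono : MonotoneOn ψ (Set.Ici 0) := by
    refine monotoneOn_of_deriv_nonneg (convex_Ici 0)
      (fun s _ => (hder s).continuousAt.continuousWithinAt)
      (fun s _ => (hder s).differentiableAt.differentiableWithinAt) fun s hs => ?_
    rw [interior_Ici] at hs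
    rw [(hder s).deriv]
    exact hnn s (le_of_lt hs)
  have hle := hmono (Set.mem_Ici.2 le_rfl) (Set.mem_Ici.2 ht) ht
  have hψ0 : ψ 0 = -∑ z, f z * (1 - v z) := by
    simp only [ψ, P, neg_zero, zero_smul, NormedSpace.exp_zero, Real.exp_zero, one_mul,
      one_apply_eq_self, ← Finset.sum_neg_distrib]
    exact Finset.sum_congr rfl fun z _ => by ring
  -- Here `v ≤ 1` is used again, now at time `t`.
  have hψt : ψ t ≤ -((1 - Real.exp (-t)) * ∑ z, P t z) := by
    rw [Finset.mul_sum, ← Finset.sum_neg_distrib]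
    refine Finset.sum_le_sum fun z _ => ?_
    have hP : 0 ≤ P t z := exp_reducedLaplacian_nonneg G hf ht z
    have := mul_le_mul_of_nonneg_left (h1 z) (Real.exp_nonneg (-t))
    nlinarith
  change (1 - Real.exp (-t)) * ∑ z, P t z ≤ _
  linarith

theorem sum_dirichletHeatKernel_le (o : V) (r : ℕ) {v : V → ℝ} (h1 : ∀ x, v x ≤ 1)
    (hv : ∀ x, laplacian G v x ≤ - v x) {t : ℝ} (ht : 0 < t) (x : V)
    (s : Finset V) :
    ∑ y ∈ s, dirichletHeatKernel G o r t x y ≤ (1 - v x) / (1 - Real.exp (-t)) := by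
  classical
  have hpos : 0 < 1 - Real.exp (-t) := by
    have : Real.exp (-t) < 1 := Real.exp_lt_one_iff.2 (by linarith)
    linarith
  by_cases hx : x ∈ interiorBall G o r
  · have hδ : (0 : interiorBall G o r → ℝ) ≤ Pi.single ⟨x, hx⟩ 1 :=
      Pi.single_nonneg.2 zero_le_one
    have key := sum_exp_reducedLaplacian_le G o r h1 hv hδ ht.le
    rw [le_div_iff₀' hpos]
    refine le_trans (mul_le_mul_of_nonneg_left ?_ hpos.le) (key.trans ?_)
    · simp only [dirichletHeatKernel, hx, dif_pos]
      set F := NormedSpace.exp ((-t) • reducedLaplacian G o r)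
        (Pi.single (M := fun _ : interiorBall G o r => ℝ) ⟨x, hx⟩ 1) with hF
      have hF0 : 0 ≤ F := exp_reducedLaplacian_nonneg G hδ ht.le
      have hsum := sum_interiorBall_extendZero G o r F 1
      simp only [Pi.one_apply, mul_one] at hsum
      rw [← hsum]
      calc ∑ y ∈ s, extendZero G o r F y
          ≤ ∑ y ∈ s ∪ interiorBall G o r, extendZero G o r F y :=
            Finset.sum_le_sum_of_subset_of_nonneg Finset.subset_union_left
              fun y _ _ => extendZero_nonneg G hF0 y
        _ = ∑ y ∈ interiorBall G o r, extendZero G o r F y :=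
            (Finset.sum_subset Finset.subset_union_right
              fun y _ hy => extendZero_of_notMem G F hy).symm
    · simp [Pi.single_apply]
  · have : ∑ y ∈ s, dirichletHeatKernel G o r t x y = 0 :=
      Finset.sum_eq_zero fun y _ => by simp [dirichletHeatKernel, hx]
    rw [this]
    exact div_nonneg (by linarith [h1 x]) hpos.le

/-- A function with `v ≤ 1` and `Δ v ≤ -v` that is positive somewhere forces the heat semigroup to
lose mass. -/
theorem stochasticallyIncomplete_of_subharmonic {v : V → ℝ} (h1 : ∀ x, v x ≤ 1)
    (hv : ∀ x, laplacian G v x ≤ - v x) {x : V} (hx : 0 < v x) :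
    StochasticallyIncomplete G := by
  intro o
  have hlog : Real.log (v x / 2) < 0 := Real.log_neg (by linarith) (by linarith [h1 x])
  refine ⟨x, -Real.log (v x / 2), by linarith, ?_⟩
  -- With `e^{-t} = v x / 2` the bound becomes `(1 - v x) / (1 - v x / 2)`, which is below `1`.
  set t := -Real.log (v x / 2) with ht
  have ht0 : 0 < t := by linarith
  have hexp : Real.exp (-t) = v x / 2 := by
    rw [ht, neg_neg, Real.exp_log (by linarith)]
  set q := (1 - v x) / (1 - Real.exp (-t)) with hq
  have hq1 : q < 1 := by
    rw [hq, hexp, div_lt_one (by linarith [h1 x])]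
    linarith
  have hle : ∀ r (s : Finset V), ∑ y ∈ s, dirichletHeatKernel G o r t x y ≤ q :=
    fun r s => sum_dirichletHeatKernel_le G o r h1 hv ht0 x s
  have hlim : ∀ y, Filter.Tendsto (fun r : ℕ => dirichletHeatKernel G o r t x y) Filter.atTop
      (nhds (heatKernel G o t x y)) := by
    intro y
    -- Monotone and bounded in `r`, so `limUnder` is a genuine limit.
    refine tendsto_nhds_limUnder ⟨_, tendsto_atTop_ciSup
      (dirichletHeatKernel_mono G o ht0.le x y) ⟨q, ?_⟩⟩
    rintro _ ⟨r, rfl⟩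
    simpa using hle r {y}
  have hnn : ∀ y, 0 ≤ heatKernel G o t x y := fun y =>
    ge_of_tendsto' (hlim y) fun r => dirichletHeatKernel_nonneg G o r ht0.le x y
  have hfin : ∀ s : Finset V, ∑ y ∈ s, heatKernel G o t x y ≤ q := fun s =>
    le_of_tendsto' (tendsto_finsetSum s fun y _ => hlim y) fun r => hle r s
  have hsum := summable_of_sum_le hnn hfin
  exact ⟨hlim, hsum, (hsum.tsum_le_of_sum_le hfin).trans_lt hq1⟩

end
-- Spheres and radial functions
section
variable {V : Type*} (G : SimpleGraph V)

theorem mem_sphere_dist (hG : G.Connected) (o x : V) : x ∈ sphere G o (G.dist o x) :=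
  (hG.preconnected o x).coe_dist_eq_edist.symm

theorem minPlus_le {H : Set V} {o x : V} {r : ℕ} (hx : x ∈ sphere G o r ∩ H) :
    minPlus G H o r ≤ mPlus G o x :=
  Nat.sInf_le (Set.mem_image_of_mem _ hx)

variable [G.LocallyFinite]

theorem mPlus_eq_card (hG : G.Connected) (o x : V) :
    mPlus G o x = {y ∈ G.neighborFinset x | G.dist o y = G.dist o x + 1}.card := by
  rw [mPlus, ← Set.ncard_coe_finset]
  congr 1
  ext y
  simp [← (hG.preconnected _ _).coe_dist_eq_edist, ← Nat.cast_add_one, -Nat.cast_add]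

theorem mMinus_eq_card (hG : G.Connected) (o x : V) :
    mMinus G o x = {y ∈ G.neighborFinset x | G.dist o y + 1 = G.dist o x}.card := by
  rw [mMinus, ← Set.ncard_coe_finset]
  congr 1
  ext y
  simp [← (hG.preconnected _ _).coe_dist_eq_edist, ← Nat.cast_add_one, -Nat.cast_add]

theorem sphere_finite (o : V) (r : ℕ) : (sphere G o r).Finite :=
  (ball_finite G o r).subset fun _ hx => le_of_eq hx

/-- Finiteness of the sphere matters: `sSup` of an unbounded set of naturals is `0`. -/
theorem mMinus_le {H : Set V} {o x : V} {r : ℕ} (hx : x ∈ sphere G o r ∩ H) :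
    mMinus G o x ≤ maxMinus G H o r :=
  le_csSup (((sphere_finite G o r).inter_of_left H).image _).bddAbove (Set.mem_image_of_mem _ hx)

/-- The first step of a geodesic from `x` to `o` is such a neighbour. -/
theorem one_le_mMinus (hG : G.Connected) {o x : V} (hx : x ≠ o) : 1 ≤ mMinus G o x := by
  rw [mMinus_eq_card G hG, Nat.one_le_iff_ne_zero, Finset.card_ne_zero]
  obtain ⟨p, hp⟩ := hG.exists_walk_length_eq_dist x o
  cases p with
  | nil => exact absurd rfl hx
  | @cons _ y _ h q =>
    refine ⟨y, ?_⟩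
    rw [Finset.mem_filter, SimpleGraph.mem_neighborFinset]
    refine ⟨h, ?_⟩
    have h1 := SimpleGraph.dist_le q
    have h2 := hG.dist_triangle (u := x) (v := y) (w := o)
    rw [SimpleGraph.dist_eq_one_iff_adj.2 h] at h2
    rw [SimpleGraph.Walk.length_cons] at hp
    rw [SimpleGraph.dist_comm (u := o), SimpleGraph.dist_comm (u := o)]
    omega

/-- The Laplacian of a function that is a radial one near `x`. -/
theorem laplacian_radial_le (hG : G.Connected) (o x : V) {v : V → ℝ} {g : ℕ → ℝ}
    (hg : ∀ n, 0 ≤ g n) (hx : v x = g (G.dist o x))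
    (hv : ∀ y, G.Adj x y → v y = g (G.dist o y)) :
    laplacian G v x ≤ mPlus G o x * (g (G.dist o x) - g (G.dist o x + 1)) +
      mMinus G o x * g (G.dist o x) := by
  rw [laplacian_apply, mPlus_eq_card G hG, mMinus_eq_card G hG, Finset.card_filter,
    Finset.card_filter]
  push_cast
  rw [Finset.sum_mul, Finset.sum_mul, ← Finset.sum_add_distrib]
  refine Finset.sum_le_sum fun y hy => ?_
  have hxy : G.Adj x y := by simpa using hy
  rw [hv y hxy, hx]
  have hgx := hg (G.dist o x)
  have hgy := hg (G.dist o y)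
  have h1 := hG.dist_triangle (u := o) (v := x) (w := y)
  have h2 := hG.dist_triangle (u := o) (v := y) (w := x)
  rw [SimpleGraph.dist_eq_one_iff_adj.2 hxy] at h1
  rw [SimpleGraph.dist_eq_one_iff_adj.2 hxy.symm] at h2
  rcases lt_trichotomy (G.dist o y) (G.dist o x) with h | h | h
  -- For an inward neighbour the value `g (G.dist o y) ≥ 0` is simply dropped.
  · have e1 : G.dist o y + 1 = G.dist o x := by omega
    have e2 : G.dist o y ≠ G.dist o x + 1 := by omega
    rw [if_pos e1, if_neg e2]
    linarith
  · simp [h]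
  · have e1 : G.dist o y + 1 ≠ G.dist o x := by omega
    have e2 : G.dist o y = G.dist o x + 1 := by omega
    rw [if_neg e1, if_pos e2, e2]
    linarith

end

/-- The radial profile with `g (r + 1) = (1 + 2 a r) g r` for `r ≥ 1`. -/
noncomputable def profile (a : ℕ → ℝ) : ℕ → ℝ
  | 0 => 0
  | r + 1 => ∏ i ∈ Finset.range r, (1 + 2 * a i)

theorem profile_nonneg {a : ℕ → ℝ} (ha : ∀ i, 0 ≤ a i) (r : ℕ) : 0 ≤ profile a r := by
  cases r with
  | zero => exact le_rfl
  | succ r => exact Finset.prod_nonneg fun i _ => by linarith [ha i]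

/-- The bound is `1 + x ≤ e^x` applied to each factor. -/
theorem profile_le {a : ℕ → ℝ} (ha : ∀ i, 0 ≤ a i) (hs : Summable a) (r : ℕ) :
    profile a r ≤ Real.exp (2 * ∑' i, a i) := by
  cases r with
  | zero => exact (Real.exp_pos _).le
  | succ r =>
    refine (Real.prod_one_add_le_exp_sum _ fun i => by linarith [ha i]).trans
      (Real.exp_le_exp.2 ?_)
    rw [← Finset.mul_sum]
    exact mul_le_mul_of_nonneg_left (hs.sum_le_tsum _ fun i _ => ha i) zero_le_two

end GraphHeat

/-! ### The subharmonic function carried by `H` -/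

theorem mainTheorem4 {V : Type*} [Infinite V] (G : SimpleGraph V) [G.LocallyFinite]
    (hG : G.Connected) (H : Set V) (x₀ : V) (hx₀ : x₀ ∈ H)
    (hsep : ∀ x ∈ H, ∀ y ∉ H, G.Adj x y → x = x₀)
    (hne : ∀ r : ℕ, 1 ≤ r → (GraphHeat.sphere G x₀ r ∩ H).Nonempty)
    (hpos : ∀ r : ℕ, 1 ≤ r → 0 < GraphHeat.minPlus G H x₀ r)
    (hsum : Summable fun r : ℕ =>
      (GraphHeat.maxMinus G H x₀ (r + 1) : ℝ) / (GraphHeat.minPlus G H x₀ (r + 1) : ℝ)) :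
    GraphHeat.StochasticallyIncomplete G := by
  classical
  set a : ℕ → ℝ := fun r =>
    (GraphHeat.maxMinus G H x₀ (r + 1) : ℝ) / (GraphHeat.minPlus G H x₀ (r + 1) : ℝ) with ha
  have ha0 : ∀ i, 0 ≤ a i := fun i => by positivity
  set C := Real.exp (2 * ∑' i, a i)
  have hC : 0 < C := Real.exp_pos _
  let g : ℕ → ℝ := fun r => GraphHeat.profile a r / C
  have hg0 : ∀ n, 0 ≤ g n := fun n => div_nonneg (GraphHeat.profile_nonneg ha0 n) hC.le
  have hg1 : ∀ n, g n ≤ 1 := fun n => (div_le_one hC).2 (GraphHeat.profile_le ha0 hsum n)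
  have hgz : g 0 = 0 := by simp [g, GraphHeat.profile]
  -- Index shift: `a r` is the ratio on the sphere of radius `r + 1`, so it governs the passage from
  -- `r + 1` to `r + 2`.
  have hgs : ∀ r, g (r + 2) = (1 + 2 * a r) * g (r + 1) := fun r => by
    simp only [g, GraphHeat.profile, Finset.prod_range_succ]
    ring
  let v : V → ℝ := fun x => if x ∈ H then g (G.dist x₀ x) else 0
  have hvH : ∀ x ∈ H, v x = g (G.dist x₀ x) := fun x hx => if_pos hx
  have hv0 : ∀ x, 0 ≤ v x := fun x => by
    by_cases hx : x ∈ H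
    · rw [hvH x hx]; exact hg0 _
    · exact (if_neg hx).ge
  have hv1 : ∀ x, v x ≤ 1 := fun x => by
    by_cases hx : x ∈ H
    · rw [hvH x hx]; exact hg1 _
    · exact (if_neg hx).trans_le zero_le_one
  -- A zero of `v ≥ 0` is a minimum; this covers `x₀` and everything off `H`.
  have hzero : ∀ x, v x = 0 → GraphHeat.laplacian G v x ≤ -v x := fun x hx => by
    rw [GraphHeat.laplacian_apply, hx, neg_zero]
    exact Finset.sum_nonpos fun y _ => by linarith [hv0 y]
  have hv : ∀ x, GraphHeat.laplacian G v x ≤ -v x := by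
    intro x
    by_cases hx : x ∈ H
    swap
    · exact hzero x (if_neg hx)
    by_cases hxx : x = x₀
    · refine hzero x ?_
      rw [hvH x hx, hxx, SimpleGraph.dist_self, hgz]
    have hnb : ∀ y, G.Adj x y → v y = g (G.dist x₀ y) := fun y hy =>
      hvH y (by_contra fun h => hxx (hsep x hx y h hy))
    refine (GraphHeat.laplacian_radial_le G hG x₀ x hg0 (hvH x hx) hnb).trans ?_
    have hmem := GraphHeat.mem_sphere_dist G hG x₀ x
    have hm1 := GraphHeat.one_le_mMinus G hG hxx
    obtain ⟨r, hr⟩ : ∃ r, G.dist x₀ x = r + 1 :=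
      Nat.exists_eq_succ_of_ne_zero (hG.pos_dist_of_ne (Ne.symm hxx)).ne'
    rw [hvH x hx, hr, hgs r]
    rw [hr] at hmem
    have hp : (GraphHeat.minPlus G H x₀ (r + 1) : ℝ) ≤ GraphHeat.mPlus G x₀ x := by
      exact_mod_cast GraphHeat.minPlus_le G ⟨hmem, hx⟩
    have hm : (GraphHeat.mMinus G x₀ x : ℝ) ≤ GraphHeat.maxMinus G H x₀ (r + 1) := by
      exact_mod_cast GraphHeat.mMinus_le G ⟨hmem, hx⟩
    have hm1' : (1 : ℝ) ≤ GraphHeat.mMinus G x₀ x := by exact_mod_cast hm1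
    have hp0 : (0 : ℝ) < GraphHeat.minPlus G H x₀ (r + 1) := by
      exact_mod_cast hpos (r + 1) (Nat.le_add_left _ _)
    have har : (GraphHeat.minPlus G H x₀ (r + 1) : ℝ) * a r =
        GraphHeat.maxMinus G H x₀ (r + 1) := mul_div_cancel₀ _ hp0.ne'
    have hpa := mul_le_mul_of_nonneg_right hp (ha0 r)
    -- The factor `2` is spent here: `2 m₊ a ≥ 2 m₋ ≥ m₋ + 1`, the last step because `m₋ ≥ 1`. One
    -- `m₋` pays for the inward loss, the remaining `1` gives `-v`.
    have := mul_nonneg (hg0 (r + 1)) (show (0 : ℝ) ≤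
      2 * (GraphHeat.mPlus G x₀ x * a r) - GraphHeat.mMinus G x₀ x - 1 by linarith)
    linarith
  -- On the first sphere the profile is an empty product, so `v x = 1 / C > 0`.
  obtain ⟨x, hxs, hxH⟩ := hne 1 le_rfl
  refine GraphHeat.stochasticallyIncomplete_of_subharmonic G hv1 hv (x := x) ?_
  have hd : G.dist x₀ x = 1 := by
    have : G.edist x₀ x = 1 := by exact_mod_cast hxs
    exact SimpleGraph.dist_eq_one_iff_adj.2 (SimpleGraph.edist_eq_one_iff_adj.1 this)
  rw [hvH x hxH, hd]
  simpa [g, GraphHeat.profile] using hC
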